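/- **Complex Mean Value Theorem.** Let $F$ be a Dedekind complete real $\Phi$-algebra, that is, a Dedekind complete vector lattice with an associative multiplication that is an $f$-algebra (products of positive elements are positive, and $x\wedge y=0$, $z\ge 0$ imply $(zx)\wedge y=(xz)\wedge y=0$) and has a multiplicative unit $e$. Let $E=F+iF$ be its complexification, with the multiplication extended from $F$ and with the modulus $|x+iy|=\sup\{(\cos\theta)x+(\sin\theta)y:\theta\in[0,2\pi]\}$ for $x,y\in F$; thus $E$ is a Dedekind complete complex $\Phi$-algebra. For $x,y\in F$ write $x\ll y$ if $y-x$ is a weak order unit of $F$ (a positive element to which only $0$ is disjoint). For $c\in E$ and a weak order unit $r$ put $N(c,r)=\{z\in E:|z-c|\ll r\}$, and let $(0,e)=\{x\in F:0\ll x\ll e\}$. A function $f$ from a set $D\subseteq E$ to $E$ is super order differentiable at $c_0\in D$ with derivative $f'(c_0)\in E$ if there is a weak order unit $s$ with $N(c_0,s)\subseteq D$ and, for every downwards directed set $\Delta\subseteq F$ with $\inf\Delta=0$, there is a set $\mathcal E\subseteq F$ with $\inf\mathcal E=0$ such that for every $\varepsilon\in\mathcal E$ there is a $\delta\in\Delta$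 such that for all $z\in D$ $$|z-c_0|\le\delta\ \Longrightarrow\ |f(z)-f(c_0)-(z-c_0)f'(c_0)|\le|z-c_0|\,\varepsilon .$$ Let $c\in E$, let $r$ be a weak order unit, and let $f:N(c,r)\to E$ be super order differentiable at every point of $N(c,r)$, with derivative $f'$. Then for any $a,b\in N(c,r)$ there exist $u,v\in\{a+x(b-a):x\in(0,e)\}$ such that 1. $\operatorname{Re}((b-a)f'(u))=\operatorname{Re}(f(b)-f(a))$, and 2. $\operatorname{Im}((b-a)f'(v))=\operatorname{Im}(f(b)-f(a))$. -/

import Mathlib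

/-- A (real) `Φ`-algebra: an `f`-algebra (a vector lattice with an associative positive
multiplication such that multiplying by positive elements preserves disjointness) that has a
multiplicative unit `e`, which is the `1` of the ring structure. Commutativity of the
multiplication is not part of the definition. -/
class IsPhiAlgebra (F : Type*) [Ring F] [Lattice F] [Algebra ℝ F] : Prop
    extends IsOrderedAddMonoid F, PosSMulMono ℝ F where
  /-- Products of positive elements are positive. -/
  protected mul_nonneg : ∀ x y : F, 0 ≤ x → 0 ≤ y → 0 ≤ x * y
  mul_left_inf_eq_zero : ∀ x y z : F, x ⊓ y = 0 → 0 ≤ z → (z * x) ⊓ y = 0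
  mul_right_inf_eq_zero : ∀ x y z : F, x ⊓ y = 0 → 0 ≤ z → (x * z) ⊓ y = 0

/-- The complexification `F + iF`, whose elements `x + iy` are the pairs `(x, y)`. -/
@[ext]
structure Complexification (F : Type*) where
  re : F
  im : F

namespace Complexification

section Algebraic

variable {F : Type*} [Ring F]

/-- The embedding of the real part `F` into `F + iF`. -/
def ofReal (x : F) : Complexification F := ⟨x, 0⟩

instance : Zero (Complexification F) := ⟨⟨0, 0⟩⟩
instance : One (Complexification F) := ⟨⟨1, 0⟩⟩
instance : Add (Complexification F) := ⟨fun z w => ⟨z.re + w.re, z.im + w.im⟩⟩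
instance : Neg (Complexification F) := ⟨fun z => ⟨-z.re, -z.im⟩⟩
instance : Sub (Complexification F) := ⟨fun z w => ⟨z.re - w.re, z.im - w.im⟩⟩
instance : Mul (Complexification F) :=
  ⟨fun z w => ⟨z.re * w.re - z.im * w.im, z.re * w.im + z.im * w.re⟩⟩

@[simp] theorem ofReal_re (x : F) : (ofReal x).re = x := rfl
@[simp] theorem ofReal_im (x : F) : (ofReal x).im = 0 := rfl
@[simp] theorem zero_re : (0 : Complexification F).re = 0 := rfl
@[simp] theorem zero_im : (0 : Complexification F).im = 0 := rfl
@[simp] theorem one_re : (1 : Complexification F).re = 1 := rfl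
@[simp] theorem one_im : (1 : Complexification F).im = 0 := rfl
@[simp] theorem add_re (z w : Complexification F) : (z + w).re = z.re + w.re := rfl
@[simp] theorem add_im (z w : Complexification F) : (z + w).im = z.im + w.im := rfl
@[simp] theorem neg_re (z : Complexification F) : (-z).re = -z.re := rfl
@[simp] theorem neg_im (z : Complexification F) : (-z).im = -z.im := rfl
@[simp] theorem sub_re (z w : Complexification F) : (z - w).re = z.re - w.re := rfl
@[simp] theorem sub_im (z w : Complexification F) : (z - w).im = z.im - w.im := rfl
@[simp] theorem mul_re (z w : Complexification F) :
    (z * w).re = z.re * w.re - z.im * w.im := rfl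
@[simp] theorem mul_im (z w : Complexification F) :
    (z * w).im = z.re * w.im + z.im * w.re := rfl

instance : Ring (Complexification F) where
  add_assoc _ _ _ := by ext <;> simp [add_assoc]
  zero_add _ := by ext <;> simp
  add_zero _ := by ext <;> simp
  add_comm _ _ := by ext <;> simp [add_comm]
  nsmul := nsmulRec
  zsmul := zsmulRec
  neg_add_cancel _ := by ext <;> simp
  sub_eq_add_neg _ _ := by ext <;> simp [sub_eq_add_neg]
  left_distrib _ _ _ := by ext <;> simp [mul_add] <;> abel
  right_distrib _ _ _ := by ext <;> simp [add_mul] <;> abel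
  zero_mul _ := by ext <;> simp
  mul_zero _ := by ext <;> simp
  mul_assoc _ _ _ := by ext <;> simp <;> noncomm_ring
  one_mul _ := by ext <;> simp
  mul_one _ := by ext <;> simp

end Algebraic

section Modulus

variable {F : Type*} [Ring F] [ConditionallyCompleteLattice F] [Algebra ℝ F]

/-- The modulus `|x + iy| = sup {(cos θ) x + (sin θ) y : θ ∈ [0, 2π]}`. -/
noncomputable def modulus (z : Complexification F) : F :=
  sSup ((fun θ : ℝ => Real.cos θ • z.re + Real.sin θ • z.im) '' Set.Icc 0 (2 * Real.pi))

theorem smul_le_abs_of_abs_le_one [IsPhiAlgebra F] (t : ℝ) (ht : |t| ≤ 1) (x : F) :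
    t • x ≤ |x| := by
  obtain ⟨h1, h2⟩ := abs_le.mp ht
  have key : ∀ s : ℝ, 0 ≤ s → s ≤ 1 → ∀ y : F, y ≤ |x| → s • y ≤ |x| := by
    intro s hs0 hs1 y hy
    have h3 : s • y ≤ s • |x| := smul_le_smul_of_nonneg_left hy hs0
    have h4 : 0 ≤ (1 - s) • |x| := smul_nonneg (sub_nonneg.mpr hs1) (abs_nonneg x)
    rw [sub_smul, one_smul, sub_nonneg] at h4
    exact h3.trans h4
  rcases le_total 0 t with h | h
  · exact key t h h2 x (le_abs_self x)
  · have h5 := key (-t) (by linarith) (by linarith) (-x) (neg_le_abs x)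
    simpa using h5

/-- The supremum that defines the modulus always exists. -/
theorem isLUB_modulus [IsPhiAlgebra F] (z : Complexification F) :
    IsLUB ((fun θ : ℝ => Real.cos θ • z.re + Real.sin θ • z.im) '' Set.Icc 0 (2 * Real.pi))
      (modulus z) := by
  refine isLUB_csSup ⟨_, 0, ⟨le_rfl, by positivity⟩, rfl⟩ ⟨|z.re| + |z.im|, ?_⟩
  rintro _ ⟨θ, -, rfl⟩
  exact add_le_add (smul_le_abs_of_abs_le_one _ (Real.abs_cos_le_one θ) _)
    (smul_le_abs_of_abs_le_one _ (Real.abs_sin_le_one θ) _)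

end Modulus

end Complexification

section Order

variable {F : Type*} [Ring F] [Lattice F]

/-- A weak order unit: a positive element to which only `0` is disjoint. -/
def IsWeakOrderUnit (r : F) : Prop :=
  0 ≤ r ∧ ∀ x : F, |x| ⊓ r = 0 → x = 0

/-- The relation `x ≪ y`: the difference `y - x` is a weak order unit. -/
def WeakUnitLT (x y : F) : Prop := IsWeakOrderUnit (y - x)

/-- The order open interval `(a, b) = {x : a ≪ x ≪ b}` in the real part. -/
def orderOpenInterval (a b : F) : Set F := {x | WeakUnitLT a x ∧ WeakUnitLT x b}

/-- `A ↘ 0`: the infimum of `A` is `0`. -/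
def InfimumZero (A : Set F) : Prop := IsGLB A 0

/-- `A ↓ 0`: the set `A` is directed downwards and its infimum is `0`. -/
def DirectedInfimumZero (A : Set F) : Prop := InfimumZero A ∧ DirectedOn (fun x y => y ≤ x) A

end Order

namespace Complexification

variable {F : Type*} [Ring F] [ConditionallyCompleteLattice F] [Algebra ℝ F]

/-- The order neighbourhood `N(c, r) = {z : |z - c| ≪ r}`. -/
def orderNhd (c : Complexification F) (r : F) : Set (Complexification F) :=
  {z | WeakUnitLT (modulus (z - c)) r}

/-- `f`, regarded as a function with domain `D`, is super order differentiable at `c ∈ D` with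
derivative `f'c`. Values of `f` outside `D` play no role. -/
def HasSuperOrderDerivAt (f : Complexification F → Complexification F)
    (D : Set (Complexification F)) (f'c c : Complexification F) : Prop :=
  c ∈ D ∧ ∃ r : F, IsWeakOrderUnit r ∧ orderNhd c r ⊆ D ∧
    ∀ Δ : Set F, DirectedInfimumZero Δ → ∃ Eps : Set F, InfimumZero Eps ∧
      ∀ ε ∈ Eps, ∃ δ ∈ Δ, ∀ z ∈ D, modulus (z - c) ≤ δ →
        modulus (f z - f c - (z - c) * f'c) ≤ modulus (z - c) * ε

/-- The segment `{a + x (b - a) : x ∈ (0, e)}`. -/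
def orderOpenSegment (a b : Complexification F) : Set (Complexification F) :=
  {w | ∃ x ∈ orderOpenInterval (0 : F) 1, w = a + ofReal x * (b - a)}

end Complexification

set_option linter.unusedSectionVars false

namespace PhiAlgebra

/-! ### Components of the unit in a unital f-algebra -/

section Basic

variable {F : Type*} [Ring F] [Lattice F] [Algebra ℝ F] [IsPhiAlgebra F]

/-! For `P` the real or the imaginary part, put `h x = P (f (a + x (b - a))) - x P (f b - f a)` on
the order interval `[0, 1]` of `F`. Then `h 0 = h 1`, and the claim is Rolle's theorem for `h` with
a point strictly inside in the weak unit sense. The usual argument through an extremum is not at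
hand, since the order is partial; it is replaced by bisection and chords.

Case distinctions are made on components `e` of the unit, which are central idempotents: an element
is positive on some component and nonpositive on the complement (`exists_posComponent`), and choices
made on both are glued as `e x + (1 - e) y`. Gluing is compatible with `h` because a differentiable
function is pointwise Lipschitz, and such functions are local: `d x = d y` implies `d h x = d h y`
(`PointwiseLipOn.local`). Bisection with a choice of half on each component then gives an
intermediate value theorem.

Applied to `h (x + v) - h x`, it yields horizontal chords. A chord of length `1/3` can be found
whose left end is a weak unit away from `0` and from `2/3` (`exists_interior_zero`). Halving it
repeatedly (`PointwiseLipOn.exists_half_chord`) gives nested horizontal chords shrinking to a point,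
and there the derivative vanishes because the chords have slope zero and straddle the point. -/

theorem mul_mul_eq_zero_of_inf_eq_zero {x y z : F} (h : x ⊓ y = 0) (hz : 0 ≤ z) :
    x * z * y = 0 := by
  have hx : 0 ≤ x := h ▸ inf_le_left
  have hy : 0 ≤ y := h ▸ inf_le_right
  have h1 : (x * z) ⊓ y = 0 := IsPhiAlgebra.mul_right_inf_eq_zero x y z h hz
  have h2 := IsPhiAlgebra.mul_right_inf_eq_zero _ _ _ h1 hy
  rw [inf_comm] at h2
  have h3 := IsPhiAlgebra.mul_left_inf_eq_zero _ _ _ h2 (IsPhiAlgebra.mul_nonneg x z hx hz)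
  rwa [inf_idem] at h3

theorem mul_self_nonneg (x : F) : 0 ≤ x * x := by
  have h0 : (x⁺ ⊓ x⁻ : F) = 0 := posPart_inf_negPart_eq_zero x
  have key : ∀ y z : F, y ⊓ z = 0 → y * z = 0 := by
    intro y z h
    have hy : 0 ≤ y := h ▸ inf_le_left
    have hz : 0 ≤ z := h ▸ inf_le_right
    have h1 := IsPhiAlgebra.mul_right_inf_eq_zero y z z h hz
    rw [inf_comm] at h1
    have h2 := IsPhiAlgebra.mul_left_inf_eq_zero _ _ _ h1 hy
    rwa [inf_idem] at h2
  have h1 := key _ _ h0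
  have h2 := key _ _ ((inf_comm _ _).trans h0)
  have h3 : x * x = x⁺ * x⁺ + x⁻ * x⁻ := by
    conv_lhs => rw [← posPart_sub_negPart x]
    rw [sub_mul, mul_sub, mul_sub, h1, h2]
    abel
  rw [h3]
  exact add_nonneg (IsPhiAlgebra.mul_nonneg _ _ (posPart_nonneg x) (posPart_nonneg x))
    (IsPhiAlgebra.mul_nonneg _ _ (negPart_nonneg x) (negPart_nonneg x))

instance : ZeroLEOneClass F := ⟨by simpa using mul_self_nonneg (1 : F)⟩

instance : IsOrderedRing F := IsOrderedRing.of_mul_nonneg IsPhiAlgebra.mul_nonneg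

theorem mul_eq_zero_of_inf_eq_zero {x y : F} (h : x ⊓ y = 0) : x * y = 0 := by
  simpa using mul_mul_eq_zero_of_inf_eq_zero h zero_le_one

theorem smul_le_smul_right_of_nonneg {s t : ℝ} (h : s ≤ t) {x : F} (hx : 0 ≤ x) :
    s • x ≤ t • x := by
  rw [← sub_nonneg, ← sub_smul]
  exact smul_nonneg (sub_nonneg.mpr h) hx

theorem nonneg_of_smul_nonneg {t : ℝ} (ht : 0 < t) {x : F} (h : 0 ≤ t • x) : 0 ≤ x := by
  have h1 := smul_nonneg (inv_nonneg.mpr ht.le) h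
  rwa [smul_smul, inv_mul_cancel₀ ht.ne', one_smul] at h1

theorem abs_smul_of_nonneg {t : ℝ} (ht : 0 ≤ t) (x : F) : |t • x| ≤ t • |x| := by
  refine abs_le'.mpr ⟨smul_le_smul_of_nonneg_left (le_abs_self x) ht, ?_⟩
  rw [← smul_neg]
  exact smul_le_smul_of_nonneg_left (neg_le_abs x) ht

theorem abs_smul_le (t : ℝ) (x : F) : |t • x| ≤ |t| • |x| := by
  rcases le_total 0 t with ht | ht
  · rw [abs_of_nonneg ht]
    exact abs_smul_of_nonneg ht x
  · rw [abs_of_nonpos ht, ← abs_neg, ← neg_smul]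
    exact abs_smul_of_nonneg (neg_nonneg.mpr ht) x

/-- Twice the difference `|u||v| - uv` is `(|u| - u)(|v| + v) + (|u| + u)(|v| - v)`, a sum of
products of positive elements. -/
theorem abs_mul_le (x y : F) : |x * y| ≤ |x| * |y| := by
  have key : ∀ u v : F, u * v ≤ |u| * |v| := by
    intro u v
    have h1 : 0 ≤ (|u| - u) * (|v| + v) :=
      mul_nonneg (sub_nonneg.mpr (le_abs_self u)) (neg_le_iff_add_nonneg.mp (neg_le_abs v))
    have h2 : 0 ≤ (|u| + u) * (|v| - v) :=
      mul_nonneg (neg_le_iff_add_nonneg.mp (neg_le_abs u)) (sub_nonneg.mpr (le_abs_self v))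
    have h3 : (2 : ℝ) • (|u| * |v| - u * v) = (|u| - u) * (|v| + v) + (|u| + u) * (|v| - v) := by
      rw [two_smul]; noncomm_ring
    have h4 : 0 ≤ (2 : ℝ) • (|u| * |v| - u * v) := h3 ▸ add_nonneg h1 h2
    exact sub_nonneg.mp (nonneg_of_smul_nonneg two_pos h4)
  refine abs_le'.mpr ⟨key x y, ?_⟩
  have := key (-x) y
  rwa [neg_mul, abs_neg] at this

/-- A component of the unit. -/
def IsComponent (e : F) : Prop := e ⊓ (1 - e) = 0

namespace IsComponent

variable {e d : F}

theorem nonneg (he : IsComponent e) : 0 ≤ e := he ▸ inf_le_left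

theorem compl_nonneg (he : IsComponent e) : 0 ≤ 1 - e := he ▸ inf_le_right

theorem le_one (he : IsComponent e) : e ≤ 1 := sub_nonneg.mp he.compl_nonneg

theorem compl (he : IsComponent e) : IsComponent (1 - e) := by
  unfold IsComponent at *
  rwa [sub_sub_cancel, inf_comm]

theorem mul_self (he : IsComponent e) : e * e = e := by
  have := mul_eq_zero_of_inf_eq_zero he
  rw [mul_sub, mul_one, sub_eq_zero] at this
  exact this.symm

theorem compl_mul_self (he : IsComponent e) : (1 - e) * e = 0 := by
  rw [sub_mul, one_mul, he.mul_self, sub_self]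

theorem mul_compl_self (he : IsComponent e) : e * (1 - e) = 0 := by
  rw [mul_sub, mul_one, he.mul_self, sub_self]

theorem mul_mul_compl (he : IsComponent e) (x : F) : e * x * (1 - e) = 0 := by
  have h1 := mul_mul_eq_zero_of_inf_eq_zero he (posPart_nonneg x)
  have h2 := mul_mul_eq_zero_of_inf_eq_zero he (negPart_nonneg x)
  rw [← posPart_sub_negPart x, mul_sub e, sub_mul (e * _), h1, h2, sub_zero]

/-- Both off-diagonal corners `e x (1 - e)` and `(1 - e) x e` vanish. Centrality of components is
all the commutativity that the argument needs. -/
theorem commute (he : IsComponent e) (x : F) : e * x = x * e := by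
  have h1 := he.mul_mul_compl x
  have h2 := he.compl.mul_mul_compl x
  rw [sub_sub_cancel, sub_mul, sub_mul, one_mul, sub_eq_zero] at h2
  rw [mul_sub, mul_one, sub_eq_zero] at h1
  rw [h1, h2]

/-- The infimum of a component and a positive element dies with their product. -/
theorem inf_eq_zero_of_mul_eq_zero (he : IsComponent e) {x : F} (hx : 0 ≤ x) (h : e * x = 0) :
    e ⊓ x = 0 := by
  have hw : 0 ≤ e ⊓ x := le_inf he.nonneg hx
  have h1 : (1 - e) * (e ⊓ x) ≤ 0 := by
    rw [← he.compl_mul_self]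
    exact mul_le_mul_of_nonneg_left inf_le_left he.compl_nonneg
  have h2 : e * (e ⊓ x) ≤ 0 := by
    rw [← h]
    exact mul_le_mul_of_nonneg_left inf_le_right he.nonneg
  refine le_antisymm ?_ hw
  calc e ⊓ x = (1 - e) * (e ⊓ x) + e * (e ⊓ x) := by noncomm_ring
    _ ≤ 0 := add_nonpos h1 h2

theorem mul (he : IsComponent e) (hd : IsComponent d) : IsComponent (e * d) := by
  have hx : 0 ≤ e * d := mul_nonneg he.nonneg hd.nonneg
  have hle : e * d ≤ d := by
    simpa using mul_le_mul_of_nonneg_right he.le_one hd.nonneg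
  have h1 : (e * d) * (1 - e * d) = 0 := by
    have : e * d * (e * d) = (e * e) * (d * d) := by
      rw [mul_assoc, ← mul_assoc d, hd.commute e]; noncomm_ring
    rw [mul_sub, mul_one, this, he.mul_self, hd.mul_self, sub_self]
  have h0 : 0 ≤ 1 - e * d := sub_nonneg.mpr (hle.trans hd.le_one)
  have hw : 0 ≤ (e * d) ⊓ (1 - e * d) := le_inf hx h0
  refine le_antisymm ?_ hw
  set w := (e * d) ⊓ (1 - e * d)
  have h2 : e * d * w ≤ 0 := by
    rw [← h1]; exact mul_le_mul_of_nonneg_left inf_le_right hx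
  have h3 : (1 - e * d) * w ≤ 0 := by
    have h4 : (1 - e * d) * (e * d) = 0 := by
      rw [sub_mul, one_mul]; rwa [mul_sub, mul_one] at h1
    rw [← h4]; exact mul_le_mul_of_nonneg_left inf_le_left h0
  calc w = e * d * w + (1 - e * d) * w := by noncomm_ring
    _ ≤ 0 := add_nonpos h2 h3

theorem mix_left (he : IsComponent e) (x y : F) : e * (e * x + (1 - e) * y) = e * x := by
  rw [mul_add, ← mul_assoc, ← mul_assoc, he.mul_self, he.mul_compl_self, zero_mul, add_zero]

theorem mix_right (he : IsComponent e) (x y : F) :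
    (1 - e) * (e * x + (1 - e) * y) = (1 - e) * y := by
  rw [mul_add, ← mul_assoc, ← mul_assoc, he.compl.mul_self, he.compl_mul_self, zero_mul, zero_add]

theorem abs_mul_le (he : IsComponent e) (x : F) : |e * x| ≤ e * |x| := by
  simpa [abs_of_nonneg he.nonneg] using PhiAlgebra.abs_mul_le e x

end IsComponent

theorem eq_mul_add_compl_mul (e x : F) : x = e * x + (1 - e) * x := by noncomm_ring

end Basic

/-! ### Archimedean property, carriers, weak order units, order continuity of multiplication -/

section Complete

variable {F : Type*} [Ring F] [ConditionallyCompleteLattice F] [Algebra ℝ F] [IsPhiAlgebra F]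

theorem nonpos_of_forall_nsmul_le {x y : F} (h : ∀ n : ℕ, n • x ≤ y) : x ≤ 0 := by
  have hb : BddAbove (Set.range fun n : ℕ => n • x) := ⟨y, by rintro _ ⟨n, rfl⟩; exact h n⟩
  have hne : (Set.range fun n : ℕ => n • x).Nonempty := ⟨_, 0, rfl⟩
  have h1 : sSup (Set.range fun n : ℕ => n • x) ≤ sSup (Set.range fun n : ℕ => n • x) - x := by
    refine csSup_le hne ?_
    rintro _ ⟨n, rfl⟩
    rw [le_sub_iff_add_le, ← succ_nsmul]
    exact le_csSup hb ⟨n + 1, rfl⟩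
  simpa using h1

/-- Dedekind complete spaces are Archimedean. -/
theorem nonpos_of_forall_le_smul {x y : F} {t : ℕ → ℝ} (ht : ∀ n, 0 < t n)
    (hlim : Filter.Tendsto t Filter.atTop (nhds 0)) (hy : 0 ≤ y)
    (h : ∀ᶠ n in Filter.atTop, x ≤ t n • y) : x ≤ 0 := by
  refine nonpos_of_forall_nsmul_le (y := y) fun m => ?_
  have h1 : ∀ᶠ n in Filter.atTop, t n < ((m : ℝ) + 1)⁻¹ := hlim.eventually_lt_const (by positivity)
  obtain ⟨n, hn, hn'⟩ := (h.and h1).exists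
  have h2 : (m : ℝ) • x ≤ (m : ℝ) • (t n • y) := smul_le_smul_of_nonneg_left hn (by positivity)
  rw [Nat.cast_smul_eq_nsmul] at h2
  refine h2.trans ?_
  rw [smul_smul]
  have h3 : (m : ℝ) * t n ≤ 1 := by
    have : t n * ((m : ℝ) + 1) < 1 := by
      have h5 := mul_lt_mul_of_pos_right hn' (by positivity : (0 : ℝ) < (m : ℝ) + 1)
      rwa [inv_mul_cancel₀ (by positivity)] at h5
    nlinarith [ht n]
  simpa using smul_le_smul_right_of_nonneg h3 hy

theorem tendsto_half_pow : Filter.Tendsto (fun n : ℕ => (1 / 2 : ℝ) ^ n) Filter.atTop (nhds 0) :=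
  tendsto_pow_atTop_nhds_zero_of_lt_one (by norm_num) (by norm_num)

/-- The square of `w - t` is positive; divide by `t`. This inequality trades a factor `w` for a
small multiple of `w * w` plus a multiple of the unit. -/
theorem two_smul_le_smul_mul_self_add {w : F} {t : ℝ} (ht : 0 < t) :
    (2 : ℝ) • w ≤ t⁻¹ • (w * w) + t • (1 : F) := by
  have h := mul_self_nonneg (w - t • (1 : F))
  have h1 : (w - t • (1 : F)) * (w - t • (1 : F))
      = t • (t⁻¹ • (w * w) + t • (1 : F) - (2 : ℝ) • w) := by
    simp only [sub_mul, mul_sub, smul_mul_assoc, mul_smul_comm, one_mul, mul_one, smul_sub,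
      smul_add, smul_smul, mul_inv_cancel₀ ht.ne', one_smul]
    rw [mul_two, add_smul]
    abel
  rw [h1] at h
  exact sub_nonneg.mp (nonneg_of_smul_nonneg ht h)

theorem eq_zero_of_mul_self_eq_zero {w : F} (hw : 0 ≤ w) (h : w * w = 0) : w = 0 := by
  refine le_antisymm ?_ hw
  have h1 : (2 : ℝ) • w ≤ 0 := by
    refine nonpos_of_forall_le_smul (y := (1 : F)) (t := fun n => (1 / 2 : ℝ) ^ n)
      (fun n => by positivity) tendsto_half_pow zero_le_one (Filter.Eventually.of_forall fun n => ?_)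
    simpa [h] using two_smul_le_smul_mul_self_add (w := w) (t := (1 / 2 : ℝ) ^ n) (by positivity)
  have h2 : 0 ≤ (2 : ℝ) • (-w) := by rw [smul_neg]; exact neg_nonneg.mpr h1
  exact neg_nonneg.mp (nonneg_of_smul_nonneg two_pos h2)

theorem inf_eq_zero_of_mul_eq_zero {x y : F} (hx : 0 ≤ x) (hy : 0 ≤ y) (h : x * y = 0) :
    x ⊓ y = 0 := by
  have hw : 0 ≤ x ⊓ y := le_inf hx hy
  refine eq_zero_of_mul_self_eq_zero hw (le_antisymm ?_ (mul_nonneg hw hw))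
  rw [← h]
  exact mul_le_mul inf_le_left inf_le_right hw hx

/-- Every positive element has a carrier among the components of the unit. -/
theorem exists_carrier_of_nonneg {p : F} (hp : 0 ≤ p) :
    ∃ e : F, IsComponent e ∧ e * p = p ∧ ∀ y : F, 0 ≤ y → y * p = 0 → y * e = 0 := by
  -- The carrier is the supremum of `(n p) ⊓ 1`, the component of `1` in the band generated by `p`.
  set S : Set F := Set.range fun n : ℕ => (n • p) ⊓ 1 with hS
  have hb : BddAbove S := ⟨1, by rintro _ ⟨n, rfl⟩; exact inf_le_right⟩
  have hne : S.Nonempty := ⟨_, 0, rfl⟩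
  have hle : ∀ n : ℕ, (n • p) ⊓ 1 ≤ sSup S := fun n => le_csSup hb ⟨n, rfl⟩
  have he0 : 0 ≤ sSup S := by simpa using hle 0
  have he1 : sSup S ≤ 1 := csSup_le hne (by rintro _ ⟨n, rfl⟩; exact inf_le_right)
  have hdisj : ∀ y : F, y ⊓ p = 0 → y ⊓ sSup S = 0 := by
    intro y hy
    have hy0 : 0 ≤ y := hy ▸ inf_le_left
    have hw : 0 ≤ y ⊓ sSup S := le_inf hy0 he0
    have hn : ∀ n : ℕ, ((n • p) ⊓ 1) ⊓ (y ⊓ sSup S) = 0 := by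
      intro n
      refine le_antisymm ?_ (le_inf (le_inf (nsmul_nonneg hp n) zero_le_one) hw)
      have h1 : y * (n • p) = 0 := by rw [mul_smul_comm, mul_eq_zero_of_inf_eq_zero hy, nsmul_zero]
      have h2 := inf_eq_zero_of_mul_eq_zero hy0 (nsmul_nonneg hp n) h1
      rw [← h2]
      exact le_inf (inf_le_right.trans inf_le_left) (inf_le_left.trans inf_le_left)
    have h3 : sSup S ≤ sSup S - y ⊓ sSup S := by
      refine csSup_le hne ?_
      rintro _ ⟨n, rfl⟩
      rw [le_sub_iff_add_le]
      have h4 := inf_add_sup ((n • p) ⊓ 1) (y ⊓ sSup S)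
      rw [hn n, zero_add] at h4
      change (n • p) ⊓ 1 + y ⊓ sSup S ≤ sSup S
      rw [← h4]
      exact sup_le (hle n) inf_le_right
    exact le_antisymm (by simpa using h3) hw
  have hcp : (1 - sSup S) ⊓ p = 0 := by
    have hw : 0 ≤ (1 - sSup S) ⊓ p := le_inf (sub_nonneg.mpr he1) hp
    have h3 : sSup S ≤ sSup S - (1 - sSup S) ⊓ p := by
      refine csSup_le hne ?_
      rintro _ ⟨n, rfl⟩
      rw [le_sub_iff_add_le]
      refine le_trans (le_inf ?_ ?_) (hle (n + 1))
      · rw [succ_nsmul]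
        exact add_le_add inf_le_left inf_le_right
      · calc (n • p) ⊓ 1 + (1 - sSup S) ⊓ p ≤ sSup S + (1 - sSup S) :=
            add_le_add (hle n) inf_le_left
          _ = 1 := by abel
    exact le_antisymm (by simpa using h3) hw
  refine ⟨sSup S, ?_, ?_, ?_⟩
  · unfold IsComponent
    rw [inf_comm]
    exact hdisj _ hcp
  · have := mul_eq_zero_of_inf_eq_zero hcp
    rw [sub_mul, one_mul, sub_eq_zero] at this
    exact this.symm
  · intro y hy h
    exact mul_eq_zero_of_inf_eq_zero (hdisj y (inf_eq_zero_of_mul_eq_zero hy hp h))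

/-- The component of the unit on which `x` is strictly positive. -/
theorem exists_posComponent (x : F) :
    ∃ e : F, IsComponent e ∧ e * x = x⁺ ∧ (1 - e) * x = -x⁻ ∧
      ∀ d : F, IsComponent d → d * x ≤ 0 → d * e = 0 := by
  obtain ⟨e, he, hep, hmin⟩ := exists_carrier_of_nonneg (posPart_nonneg x)
  have h0 : x⁻ * x⁺ = 0 := by
    refine mul_eq_zero_of_inf_eq_zero ?_
    rw [inf_comm]; exact posPart_inf_negPart_eq_zero x
  have h1 : e * x⁻ = 0 := by
    rw [he.commute]
    exact hmin _ (negPart_nonneg x) h0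
  have h2 : e * x = x⁺ := by
    conv_lhs => rw [← posPart_sub_negPart x]
    rw [mul_sub, hep, h1, sub_zero]
  refine ⟨e, he, h2, ?_, fun d hd hdx => hmin d hd.nonneg ?_⟩
  · rw [sub_mul, one_mul, h2, sub_eq_iff_eq_add, neg_add_eq_sub, posPart_sub_negPart]
  · refine le_antisymm ?_ (mul_nonneg hd.nonneg (posPart_nonneg x))
    have h3 : d * x⁺ = e * (d * x) := by
      rw [← h2, ← mul_assoc, ← mul_assoc, he.commute d]
    rw [h3]
    exact mul_nonpos_of_nonneg_of_nonpos he.nonneg hdx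

/-- An element disjoint from `r` has a carrier that annihilates `r`, so components suffice as test
elements. -/
theorem isWeakOrderUnit_of_forall_component {r : F} (hr : 0 ≤ r)
    (h : ∀ d : F, IsComponent d → d * r = 0 → d = 0) : IsWeakOrderUnit r := by
  refine ⟨hr, fun x hx => ?_⟩
  obtain ⟨e, he, hex, hmin⟩ := exists_carrier_of_nonneg (abs_nonneg x)
  have h1 : r * |x| = 0 := mul_eq_zero_of_inf_eq_zero ((inf_comm _ _).trans hx)
  have h2 := hmin r hr h1
  rw [← he.commute] at h2
  rw [h e he h2, zero_mul] at hex
  have h3 : x ≤ 0 := hex ▸ le_abs_self x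
  have h4 : -x ≤ 0 := hex ▸ neg_le_abs x
  exact le_antisymm h3 (neg_nonpos.mp h4)

theorem eq_zero_of_mul_weakOrderUnit {r y : F} (hr : IsWeakOrderUnit r) (hy : 0 ≤ y)
    (h : y * r = 0) : y = 0 :=
  hr.2 y (by rw [abs_of_nonneg hy]; exact inf_eq_zero_of_mul_eq_zero hy hr.1 h)

theorem isWeakOrderUnit_convexComb {r s x : F} (hr : IsWeakOrderUnit r) (hs : IsWeakOrderUnit s)
    (hx0 : 0 ≤ x) (hx1 : x ≤ 1) : IsWeakOrderUnit ((1 - x) * r + x * s) := by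
  have h1 : 0 ≤ (1 - x) * r := mul_nonneg (sub_nonneg.mpr hx1) hr.1
  have h2 : 0 ≤ x * s := mul_nonneg hx0 hs.1
  refine isWeakOrderUnit_of_forall_component (add_nonneg h1 h2) fun d hd h => ?_
  rw [mul_add] at h
  obtain ⟨h3, h4⟩ := (add_eq_zero_iff_of_nonneg (mul_nonneg hd.nonneg h1)
    (mul_nonneg hd.nonneg h2)).mp h
  rw [← mul_assoc] at h3 h4
  have h5 := eq_zero_of_mul_weakOrderUnit hr (mul_nonneg hd.nonneg (sub_nonneg.mpr hx1)) h3
  have h6 := eq_zero_of_mul_weakOrderUnit hs (mul_nonneg hd.nonneg hx0) h4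
  rwa [mul_sub, h6, mul_one, sub_zero] at h5

theorem isWeakOrderUnit_mono {r s : F} (hr : IsWeakOrderUnit r) (h : r ≤ s) :
    IsWeakOrderUnit s := by
  refine ⟨hr.1.trans h, fun x hx => hr.2 x (le_antisymm ?_ (le_inf (abs_nonneg x) hr.1))⟩
  rw [← hx]
  exact inf_le_inf_left _ h

theorem infimumZero_smul_half_pow {N : F} (hN : 0 ≤ N) :
    DirectedInfimumZero (Set.range fun n : ℕ => (1 / 2 : ℝ) ^ n • N) := by
  refine ⟨⟨?_, fun x hx => ?_⟩, ?_⟩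
  · rintro _ ⟨n, rfl⟩
    exact smul_nonneg (by positivity) hN
  · exact nonpos_of_forall_le_smul (t := fun n => (1 / 2 : ℝ) ^ n) (fun n => by positivity)
      tendsto_half_pow hN (Filter.Eventually.of_forall fun n => hx ⟨n, rfl⟩)
  · rintro _ ⟨n, rfl⟩ _ ⟨m, rfl⟩
    refine ⟨_, ⟨max n m, rfl⟩, ?_, ?_⟩
    · exact smul_le_smul_right_of_nonneg
        (pow_le_pow_of_le_one (by norm_num) (by norm_num) (le_max_left _ _)) hN
    · exact smul_le_smul_right_of_nonneg
        (pow_le_pow_of_le_one (by norm_num) (by norm_num) (le_max_right _ _)) hN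

/-- Multiplication by a positive element is order continuous. -/
theorem infimumZero_mul_left {N : F} (hN : 0 ≤ N) {A : Set F} (hA : InfimumZero A) :
    InfimumZero ((fun ε => N * ε) '' A) := by
  have hA0 : ∀ ε ∈ A, 0 ≤ ε := fun ε h => hA.1 h
  refine ⟨?_, fun w hw => ?_⟩
  · rintro _ ⟨ε, hε, rfl⟩
    exact mul_nonneg hN (hA0 ε hε)
  by_cases hne : A.Nonempty
  swap
  -- The empty set has infimum `0` only if `0` is the greatest element.
  · rw [Set.not_nonempty_iff_eq_empty] at hne
    subst hne
    exact hA.2 (by simp [lowerBounds])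
  obtain ⟨ε₀, hε₀⟩ := hne
  -- As `N` need not be bounded by a multiple of `1`, it is replaced by `2N ≤ t N² + t⁻¹`. This
  -- gives `2w ≤ t N² ε₀ + t⁻¹ ε`; taking the infimum over `ε` and then `t → 0` leaves `2w ≤ 0`.
  have h2w : (2 : ℝ) • w ≤ 0 := by
    refine nonpos_of_forall_le_smul (y := N * N * ε₀) (t := fun n => (1 / 2 : ℝ) ^ n)
      (fun n => by positivity) tendsto_half_pow
      (mul_nonneg (mul_nonneg hN hN) (hA0 _ hε₀)) (Filter.Eventually.of_forall fun n => ?_)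
    set t : ℝ := (1 / 2 : ℝ) ^ n with htdef
    have ht : 0 < t := by positivity
    have hNle : (2 : ℝ) • N ≤ t • (N * N) + t⁻¹ • (1 : F) := by
      simpa using two_smul_le_smul_mul_self_add (w := N) (inv_pos.mpr ht)
    have hlow : t • ((2 : ℝ) • w - t • (N * N * ε₀)) ≤ 0 := by
      refine hA.2 fun ε hε => ?_
      have hww : (2 : ℝ) • w ≤ t • (N * N * ε₀) + t⁻¹ • ε := by
        have ha : w ≤ N * ε := hw ⟨ε, hε, rfl⟩
        have hb : w ≤ N * ε₀ := hw ⟨ε₀, hε₀, rfl⟩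
        -- `A` is not assumed directed, so the meet with `ε₀` is taken by hand: multiplication by
        -- `N` keeps `ε - ε ⊓ ε₀` and `ε₀ - ε ⊓ ε₀` disjoint, hence preserves the meet.
        have hm : w ≤ N * (ε ⊓ ε₀) := by
          have h1 : 0 ≤ ε - ε ⊓ ε₀ := sub_nonneg.mpr inf_le_left
          have h2 : 0 ≤ ε₀ - ε ⊓ ε₀ := sub_nonneg.mpr inf_le_right
          have h3 : (ε - ε ⊓ ε₀) ⊓ (ε₀ - ε ⊓ ε₀) = 0 := by
            rw [← inf_sub, sub_self]
          have h4 := IsPhiAlgebra.mul_left_inf_eq_zero _ _ N h3 hN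
          rw [inf_comm] at h4
          have h5 := IsPhiAlgebra.mul_left_inf_eq_zero _ _ N h4 hN
          rw [← sub_nonpos, ← h5]
          refine le_inf ?_ ?_
          · rw [mul_sub]; exact sub_le_sub_right hb _
          · rw [mul_sub]; exact sub_le_sub_right ha _
        have hi0 : 0 ≤ ε ⊓ ε₀ := le_inf (hA0 _ hε) (hA0 _ hε₀)
        calc (2 : ℝ) • w ≤ (2 : ℝ) • (N * (ε ⊓ ε₀)) :=
              smul_le_smul_of_nonneg_left hm (by norm_num)
          _ = ((2 : ℝ) • N) * (ε ⊓ ε₀) := by rw [smul_mul_assoc]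
          _ ≤ (t • (N * N) + t⁻¹ • (1 : F)) * (ε ⊓ ε₀) := mul_le_mul_of_nonneg_right hNle hi0
          _ = t • (N * N * (ε ⊓ ε₀)) + t⁻¹ • (ε ⊓ ε₀) := by
              rw [add_mul, smul_mul_assoc, smul_mul_assoc, one_mul]
          _ ≤ t • (N * N * ε₀) + t⁻¹ • ε := by
              refine add_le_add (smul_le_smul_of_nonneg_left ?_ ht.le)
                (smul_le_smul_of_nonneg_left inf_le_left (inv_nonneg.mpr ht.le))
              exact mul_le_mul_of_nonneg_left inf_le_right (mul_nonneg hN hN)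
      have h1 : (2 : ℝ) • w - t • (N * N * ε₀) ≤ t⁻¹ • ε := sub_le_iff_le_add'.mpr hww
      have h2 := smul_le_smul_of_nonneg_left h1 ht.le
      rwa [smul_smul t t⁻¹, mul_inv_cancel₀ ht.ne', one_smul] at h2
    have h1 : 0 ≤ t • -((2 : ℝ) • w - t • (N * N * ε₀)) := by
      rw [smul_neg]; exact neg_nonneg.mpr hlow
    exact sub_nonpos.mp (neg_nonneg.mp (nonneg_of_smul_nonneg ht h1))
  have h2 : 0 ≤ (2 : ℝ) • (-w) := by rw [smul_neg]; exact neg_nonneg.mpr h2w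
  exact neg_nonneg.mp (nonneg_of_smul_nonneg two_pos h2)

end Complete

end PhiAlgebra

namespace PhiAlgebra

/-! ### Pointwise Lipschitz functions, locality and the intermediate value theorem -/

section Calculus

variable {F : Type*} [Ring F] [ConditionallyCompleteLattice F] [Algebra ℝ F] [IsPhiAlgebra F]

theorem IsComponent.mul_abs_eq_zero {d x : F} (hd : IsComponent d) (h : d * x = 0) :
    d * |x| = 0 := by
  refine le_antisymm ?_ (mul_nonneg hd.nonneg (abs_nonneg x))
  have h1 : x = (1 - d) * x := by rw [sub_mul, one_mul, h, sub_zero]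
  have h2 : |x| ≤ (1 - d) * |x| := by
    conv_lhs => rw [h1]
    exact hd.compl.abs_mul_le x
  have h3 := mul_le_mul_of_nonneg_left h2 hd.nonneg
  rwa [← mul_assoc, hd.mul_compl_self, zero_mul] at h3

/-- Pointwise Lipschitz continuity relative to the order unit `1`. -/
def PointwiseLipOn (k : F → F) (I : Set F) : Prop :=
  ∀ x ∈ I, ∃ C : F, 0 ≤ C ∧ ∃ n : ℕ, ∀ y ∈ I, |y - x| ≤ (1 / 2 : ℝ) ^ n • (1 : F) →
    |k y - k x| ≤ |y - x| * C

theorem PointwiseLipOn.mono {k : F → F} {I J : Set F} (hk : PointwiseLipOn k I) (h : J ⊆ I) :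
    PointwiseLipOn k J := by
  intro x hx
  obtain ⟨C, hC, n, hn⟩ := hk x (h hx)
  exact ⟨C, hC, n, fun y hy => hn y (h hy)⟩

theorem PointwiseLipOn.const_mul {k : F → F} {I : Set F} (hk : PointwiseLipOn k I) {s : F}
    (hs : |s| ≤ 1) : PointwiseLipOn (fun x => s * k x) I := by
  intro x hx
  obtain ⟨C, hC, n, hn⟩ := hk x hx
  refine ⟨C, hC, n, fun y hy hyx => le_trans ?_ (hn y hy hyx)⟩
  rw [← mul_sub]
  refine (abs_mul_le _ _).trans ?_
  simpa using mul_le_mul_of_nonneg_right hs (abs_nonneg (k y - k x))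

theorem half_pow_smul_le {m n : ℕ} (h : m ≤ n) {x : F} (hx : 0 ≤ x) :
    (1 / 2 : ℝ) ^ n • x ≤ (1 / 2 : ℝ) ^ m • x :=
  smul_le_smul_right_of_nonneg (pow_le_pow_of_le_one (by norm_num) (by norm_num) h) hx

theorem PointwiseLipOn.shift_sub {h : F → F} {a b v : F} (hh : PointwiseLipOn h (Set.Icc 0 1))
    (ha : 0 ≤ a) (hv : 0 ≤ v) (hb : b + v ≤ 1) :
    PointwiseLipOn (fun x => h (x + v) - h x) (Set.Icc a b) := by
  intro x hx
  have hmem : ∀ y ∈ Set.Icc a b, y ∈ Set.Icc (0 : F) 1 ∧ y + v ∈ Set.Icc (0 : F) 1 := by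
    intro y hy
    have h1 : y + v ≤ 1 := (add_le_add_left hy.2 v).trans hb
    have h2 : y ≤ y + v := le_add_of_nonneg_right hv
    exact ⟨⟨ha.trans hy.1, h2.trans h1⟩, ⟨(ha.trans hy.1).trans h2, h1⟩⟩
  obtain ⟨C, hC, n, hn⟩ := hh x (hmem x hx).1
  obtain ⟨D, hD, m, hm⟩ := hh (x + v) (hmem x hx).2
  refine ⟨C + D, add_nonneg hC hD, max n m, fun y hy hyx => ?_⟩
  have h1 := hn y (hmem y hy).1 (hyx.trans (half_pow_smul_le (le_max_left n m) zero_le_one))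
  have h2 := hm (y + v) (hmem y hy).2
    (by rw [add_sub_add_right_eq_sub]
        exact hyx.trans (half_pow_smul_le (le_max_right n m) zero_le_one))
  rw [add_sub_add_right_eq_sub] at h2
  calc |h (y + v) - h y - (h (x + v) - h x)|
      = |(h (y + v) - h (x + v)) + -(h y - h x)| := by congr 1; abel
    _ ≤ |h (y + v) - h (x + v)| + |-(h y - h x)| := abs_add_le _ _
    _ ≤ |y - x| * D + |y - x| * C := by rw [abs_neg]; exact add_le_add h2 h1
    _ = |y - x| * (C + D) := by rw [mul_add, add_comm]

theorem abs_sub_le_sub_of_mem_Icc {a b x y : F} (hx : x ∈ Set.Icc a b) (hy : y ∈ Set.Icc a b) :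
    |y - x| ≤ b - a := by
  refine abs_le'.mpr ⟨sub_le_sub hy.2 hx.1, ?_⟩
  rw [neg_sub]
  exact sub_le_sub hx.2 hy.1

theorem mem_Icc_of_component {a b x y e : F} (he : IsComponent e) (hx : x ∈ Set.Icc a b)
    (hy : y ∈ Set.Icc a b) : e * x + (1 - e) * y ∈ Set.Icc a b := by
  constructor
  · rw [eq_mul_add_compl_mul e a]
    exact add_le_add (mul_le_mul_of_nonneg_left hx.1 he.nonneg)
      (mul_le_mul_of_nonneg_left hy.1 he.compl_nonneg)
  · rw [eq_mul_add_compl_mul e b]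
    exact add_le_add (mul_le_mul_of_nonneg_left hx.2 he.nonneg)
      (mul_le_mul_of_nonneg_left hy.2 he.compl_nonneg)

theorem mem_Icc_of_segment {a b x y : F} {t : ℝ} (ht : t ∈ Set.Icc (0 : ℝ) 1)
    (hx : x ∈ Set.Icc a b) (hy : y ∈ Set.Icc a b) : x + t • (y - x) ∈ Set.Icc a b := by
  have h0 : ∀ z w : F, z + t • (w - z) = (1 - t) • z + t • w := by
    intro z w
    rw [sub_smul, one_smul, smul_sub]; abel
  have h1 : ∀ z : F, (1 - t) • z + t • z = z := by
    intro z; rw [← add_smul, sub_add_cancel, one_smul]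
  rw [h0]
  constructor
  · rw [← h1 a]
    exact add_le_add (smul_le_smul_of_nonneg_left hx.1 (sub_nonneg.mpr ht.2))
      (smul_le_smul_of_nonneg_left hy.1 ht.1)
  · rw [← h1 b]
    exact add_le_add (smul_le_smul_of_nonneg_left hx.2 (sub_nonneg.mpr ht.2))
      (smul_le_smul_of_nonneg_left hy.2 ht.1)

/-- Pointwise Lipschitz functions are local: they respect components of the unit. -/
theorem PointwiseLipOn.local {k : F → F} {a b : F} (hk : PointwiseLipOn k (Set.Icc a b))
    (ha : 0 ≤ a) (hb : b ≤ 1) {d x y : F} (hd : IsComponent d) (hx : x ∈ Set.Icc a b)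
    (hy : y ∈ Set.Icc a b) (hxy : d * x = d * y) : d * k x = d * k y := by
  -- Along the real segment from `x` to `y` the increments die under `d`, so the Lipschitz bound
  -- makes `d * k` locally constant; connectedness of the real interval `[0, 1]` compares the ends.
  let g : Set.Icc (0 : ℝ) 1 → F := fun t => d * k (x + (t : ℝ) • (y - x))
  have hg : IsLocallyConstant g := by
    rw [IsLocallyConstant.iff_eventually_eq]
    intro s
    obtain ⟨C, hC, n, hn⟩ := hk _ (mem_Icc_of_segment s.2 hx hy)
    have hball : ∀ᶠ t : Set.Icc (0 : ℝ) 1 in nhds s, dist t s < (1 / 2 : ℝ) ^ n :=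
      Metric.eventually_nhds_iff_ball.mpr ⟨(1 / 2 : ℝ) ^ n, by positivity, fun t ht => ht⟩
    filter_upwards [hball] with t ht
    rw [Subtype.dist_eq, Real.dist_eq] at ht
    have hdiff : x + (t : ℝ) • (y - x) - (x + (s : ℝ) • (y - x)) = ((t : ℝ) - s) • (y - x) := by
      rw [sub_smul]; abel
    have hle : |((t : ℝ) - s) • (y - x)| ≤ (1 / 2 : ℝ) ^ n • (1 : F) := by
      refine (abs_smul_le _ _).trans ?_
      have h1 : |y - x| ≤ 1 := (abs_sub_le_sub_of_mem_Icc hx hy).trans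
        ((sub_le_self b ha).trans hb)
      exact (smul_le_smul_of_nonneg_left h1 (abs_nonneg _)).trans
        (smul_le_smul_right_of_nonneg ht.le zero_le_one)
    have h2 := hn _ (mem_Icc_of_segment t.2 hx hy) (by rw [hdiff]; exact hle)
    rw [hdiff] at h2
    have h3 : d * |((t : ℝ) - s) • (y - x)| = 0 := by
      refine hd.mul_abs_eq_zero ?_
      rw [mul_smul_comm, mul_sub, hxy, sub_self, smul_zero]
    have h4 : |d * (k (x + (t : ℝ) • (y - x)) - k (x + (s : ℝ) • (y - x)))| ≤ 0 := by
      refine (hd.abs_mul_le _).trans ((mul_le_mul_of_nonneg_left h2 hd.nonneg).trans ?_)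
      rw [← mul_assoc, h3, zero_mul]
    obtain ⟨h5, h6⟩ := abs_le'.mp h4
    have h7 := le_antisymm h5 (neg_nonpos.mp h6)
    rwa [mul_sub, sub_eq_zero] at h7
  have h := hg.apply_eq_of_preconnectedSpace ⟨0, by simp⟩ ⟨1, by simp⟩
  simpa [g] using h

theorem PointwiseLipOn.map_mix {k : F → F} {a b : F} (hk : PointwiseLipOn k (Set.Icc a b))
    (ha : 0 ≤ a) (hb : b ≤ 1) {e x y : F} (he : IsComponent e) (hx : x ∈ Set.Icc a b)
    (hy : y ∈ Set.Icc a b) : k (e * x + (1 - e) * y) = e * k x + (1 - e) * k y := by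
  have hm := mem_Icc_of_component he hx hy
  rw [eq_mul_add_compl_mul e (k _), hk.local ha hb he hm hx (he.mix_left x y),
    hk.local ha hb he.compl hm hy (he.mix_right x y)]

/-- Nested intervals obtained by successive halving. -/
theorem exists_mem_nested {R : F → F → Prop}
    (hstep : ∀ x y, x ≤ y → R x y → ∃ x' y', x ≤ x' ∧ x' ≤ y' ∧ y' ≤ y ∧
      y' - x' = (1 / 2 : ℝ) • (y - x) ∧ R x' y') {a b : F} (hab : a ≤ b) (h0 : R a b) :
    ∃ z ∈ Set.Icc a b, ∀ n : ℕ, ∃ x y, a ≤ x ∧ x ≤ z ∧ z ≤ y ∧ y ≤ b ∧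
      y - x = (1 / 2 : ℝ) ^ n • (b - a) ∧ R x y := by
  choose X Y h1 h2 h3 h4 h5 using hstep
  let s : ℕ → {p : F × F // p.1 ≤ p.2 ∧ R p.1 p.2} := fun n =>
    Nat.rec ⟨(a, b), hab, h0⟩
      (fun _ p => ⟨(X p.1.1 p.1.2 p.2.1 p.2.2, Y p.1.1 p.1.2 p.2.1 p.2.2), h2 _ _ _ _, h5 _ _ _ _⟩) n
  have hmono : Monotone fun n => (s n).1.1 := monotone_nat_of_le_succ fun n => h1 _ _ _ _
  have hanti : Antitone fun n => (s n).1.2 := antitone_nat_of_succ_le fun n => h3 _ _ _ _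
  have hlen : ∀ n, (s n).1.2 - (s n).1.1 = (1 / 2 : ℝ) ^ n • (b - a) := by
    intro n
    induction n with
    | zero => simp [s]
    | succ n ih =>
      have := h4 (s n).1.1 (s n).1.2 (s n).2.1 (s n).2.2
      rw [ih, smul_smul, ← pow_succ'] at this
      exact this
  have hle : ∀ n m, (s n).1.1 ≤ (s m).1.2 := fun n m =>
    (hmono (le_max_left n m)).trans ((s (max n m)).2.1.trans (hanti (le_max_right n m)))
  have hbdd : BddAbove (Set.range fun n => (s n).1.1) :=
    ⟨(s 0).1.2, by rintro _ ⟨n, rfl⟩; exact hle n 0⟩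
  have hlow : ∀ n, (s n).1.1 ≤ sSup (Set.range fun n => (s n).1.1) := fun n =>
    le_csSup hbdd ⟨n, rfl⟩
  have hup : ∀ n, sSup (Set.range fun n => (s n).1.1) ≤ (s n).1.2 := fun n =>
    csSup_le ⟨_, 0, rfl⟩ (by rintro _ ⟨m, rfl⟩; exact hle m n)
  exact ⟨_, ⟨hlow 0, hup 0⟩, fun n => ⟨(s n).1.1, (s n).1.2, hmono (Nat.zero_le n), hlow n, hup n,
    hanti (Nat.zero_le n), hlen n, (s n).2.2⟩⟩

theorem half_smul_sub_nonneg {x y : F} (h : x ≤ y) : 0 ≤ (1 / 2 : ℝ) • (y - x) :=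
  smul_nonneg (by norm_num) (sub_nonneg.mpr h)

/-- Intermediate value theorem. -/
theorem PointwiseLipOn.exists_zero {k : F → F} {a b : F} (hk : PointwiseLipOn k (Set.Icc a b))
    (ha : 0 ≤ a) (hb : b ≤ 1) (hab : a ≤ b) (hka : k a ≤ 0) (hkb : 0 ≤ k b) :
    ∃ z ∈ Set.Icc a b, k z = 0 := by
  let R : F → F → Prop := fun x y => a ≤ x ∧ y ≤ b ∧ k x ≤ 0 ∧ 0 ≤ k y
  have hstep : ∀ x y, x ≤ y → R x y → ∃ x' y', x ≤ x' ∧ x' ≤ y' ∧ y' ≤ y ∧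
      y' - x' = (1 / 2 : ℝ) • (y - x) ∧ R x' y' := by
    rintro x y hxy ⟨hax, hyb, hkx, hky⟩
    set v := (1 / 2 : ℝ) • (y - x) with hv
    have hv0 : 0 ≤ v := half_smul_sub_nonneg hxy
    have hvv : x + v + v = y := by
      have : v + v = y - x := by rw [hv, ← add_smul]; norm_num
      rw [add_assoc, this]; abel
    set m := x + v
    have hxm : x ≤ m := le_add_of_nonneg_right hv0
    have hmy : m ≤ y := hvv ▸ le_add_of_nonneg_right hv0
    have hxI : x ∈ Set.Icc a b := ⟨hax, hxy.trans hyb⟩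
    have hyI : y ∈ Set.Icc a b := ⟨hax.trans hxy, hyb⟩
    have hmI : m ∈ Set.Icc a b := ⟨hax.trans hxm, hmy.trans hyb⟩
    -- Where `k m > 0` the left half `[x, m]` is kept, elsewhere the right half `[m, y]`. Both
    -- halves have length `v`, hence so does the glued interval.
    obtain ⟨e, he, he1, he2, -⟩ := exists_posComponent (k m)
    have hlen : e * m + (1 - e) * y - (e * x + (1 - e) * m) = v := by
      rw [← hvv]; simp only [m]; noncomm_ring
    refine ⟨e * x + (1 - e) * m, e * m + (1 - e) * y, ?_, ?_, ?_, hlen, ?_, ?_, ?_, ?_⟩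
    · exact (mem_Icc_of_component he (Set.left_mem_Icc.mpr hxm) (Set.right_mem_Icc.mpr hxm)).1
    · rw [← sub_nonneg, hlen]; exact hv0
    · exact (mem_Icc_of_component he (Set.left_mem_Icc.mpr hmy) (Set.right_mem_Icc.mpr hmy)).2
    · exact (mem_Icc_of_component he hxI hmI).1
    · exact (mem_Icc_of_component he hmI hyI).2
    · rw [hk.map_mix ha hb he hxI hmI, he2]
      exact add_nonpos (mul_nonpos_of_nonneg_of_nonpos he.nonneg hkx)
        (neg_nonpos.mpr (negPart_nonneg _))
    · rw [hk.map_mix ha hb he hmI hyI, he1]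
      exact add_nonneg (posPart_nonneg _) (mul_nonneg he.compl_nonneg hky)
  obtain ⟨z, hz, hzn⟩ := exists_mem_nested hstep hab ⟨le_rfl, le_rfl, hka, hkb⟩
  refine ⟨z, hz, ?_⟩
  obtain ⟨C, hC, n, hn⟩ := hk z hz
  have hba : b - a ≤ 1 := (sub_le_self b ha).trans hb
  have key : ∀ m ≥ n, k z ≤ (1 / 2 : ℝ) ^ m • C ∧ -k z ≤ (1 / 2 : ℝ) ^ m • C := by
    intro m hm
    obtain ⟨x, y, hax, hxz, hzy, hyb, hlen, -, -, hkx, hky⟩ := hzn m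
    have hsmall : y - x ≤ (1 / 2 : ℝ) ^ m • (1 : F) := by
      rw [hlen]; exact smul_le_smul_of_nonneg_left hba (by positivity)
    have hw : ∀ w ∈ Set.Icc x y, |k w - k z| ≤ (1 / 2 : ℝ) ^ m • C := by
      intro w hw
      have h1 : |w - z| ≤ (1 / 2 : ℝ) ^ m • (1 : F) :=
        (abs_sub_le_sub_of_mem_Icc ⟨hxz, hzy⟩ hw).trans hsmall
      refine (hn w ⟨hax.trans hw.1, hw.2.trans hyb⟩
        (h1.trans (half_pow_smul_le hm zero_le_one))).trans ?_
      simpa using mul_le_mul_of_nonneg_right h1 hC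
    have h1 := (abs_le'.mp (hw x ⟨le_rfl, hxz.trans hzy⟩)).2
    have h2 := (abs_le'.mp (hw y ⟨hxz.trans hzy, le_rfl⟩)).1
    constructor
    · rw [neg_sub] at h1
      exact (le_sub_self_iff (k z)).mpr hkx |>.trans h1
    · exact (neg_le_sub_iff_le_add.mpr (le_add_of_nonneg_left hky)).trans h2
  have hev := Filter.eventually_ge_atTop n
  have hz1 : k z ≤ 0 := nonpos_of_forall_le_smul (fun m => by positivity) tendsto_half_pow hC
    (hev.mono fun m hm => (key m hm).1)
  have hz2 : -k z ≤ 0 := nonpos_of_forall_le_smul (fun m => by positivity) tendsto_half_pow hC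
    (hev.mono fun m hm => (key m hm).2)
  exact le_antisymm hz1 (neg_nonpos.mp hz2)

/-- The symmetry attached to a component. -/
theorem IsComponent.sign {e : F} (he : IsComponent e) :
    |e - (1 - e)| ≤ 1 ∧ (e - (1 - e)) * (e - (1 - e)) = 1 := by
  constructor
  · refine abs_le'.mpr ⟨?_, ?_⟩
    · exact (sub_le_self e he.compl_nonneg).trans he.le_one
    · rw [neg_sub]
      exact (sub_le_self _ he.nonneg).trans (sub_le_self _ he.nonneg)
  · rw [sub_mul e (1 - e), mul_sub e e, mul_sub (1 - e) e, he.mul_self, he.compl.mul_self, he.mul_compl_self,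
      he.compl_mul_self]
    abel

theorem IsComponent.eq_zero_of_sign_mul {e x : F} (he : IsComponent e)
    (h : (e - (1 - e)) * x = 0) : x = 0 := by
  rw [← one_mul x, ← he.sign.2, mul_assoc, h, mul_zero]

/-- Intermediate value theorem for end values of opposite signs on a component and its
complement. -/
theorem PointwiseLipOn.exists_zero_of_sign {k : F → F} {a b e : F}
    (hk : PointwiseLipOn k (Set.Icc a b)) (he : IsComponent e)
    (ha : 0 ≤ a) (hb : b ≤ 1) (hab : a ≤ b) (hka : (e - (1 - e)) * k a ≤ 0)
    (hkb : 0 ≤ (e - (1 - e)) * k b) : ∃ z ∈ Set.Icc a b, k z = 0 := by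
  obtain ⟨z, hz, h⟩ := (hk.const_mul he.sign.1).exists_zero ha hb hab hka hkb
  exact ⟨z, hz, he.eq_zero_of_sign_mul h⟩

end Calculus

end PhiAlgebra

namespace PhiAlgebra

/-! ### Horizontal chords and Rolle's theorem -/

section Rolle

variable {F : Type*} [Ring F] [ConditionallyCompleteLattice F] [Algebra ℝ F] [IsPhiAlgebra F]

theorem eq_zero_of_mul_smul_one_nonpos {d : F} (hd : 0 ≤ d) {t : ℝ} (ht : 0 < t)
    (h : d * t • (1 : F) ≤ 0) : d = 0 := by
  refine le_antisymm ?_ hd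
  rw [mul_smul_comm, mul_one] at h
  have h1 : 0 ≤ t • (-d) := by rw [smul_neg]; exact neg_nonneg.mpr h
  exact neg_nonneg.mp (nonneg_of_smul_nonneg ht h1)

/-- With three sample values of sum zero and `k u ≥ 0` in the middle, one of three cases holds on
each component: `k 0 < 0 ≤ k u`, with a zero in `[0, u]`; `k 0 ≥ 0` and `k u > 0`, so that `k (2u) <
0`, with a zero in `[u, 2u]`; or `k u = 0`. No case forces the zero to an end of `[0, 2u]`. -/
theorem exists_interior_zero_of_nonneg {k : F → F} {t : ℝ} (ht : 0 < t) (ht1 : t + t ≤ 1)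
    (hk : PointwiseLipOn k (Set.Icc 0 (t • (1 : F) + t • (1 : F))))
    (hsum : k 0 + k (t • 1) + k (t • 1 + t • 1) = 0) (hq : 0 ≤ k (t • 1)) :
    ∃ z ∈ Set.Icc (0 : F) (t • 1 + t • 1), k z = 0 ∧ IsWeakOrderUnit z ∧
      IsWeakOrderUnit (t • (1 : F) + t • 1 - z) := by
  set u : F := t • (1 : F) with hu
  have hu0 : 0 ≤ u := smul_nonneg ht.le zero_le_one
  have huu : u ≤ u + u := le_add_of_nonneg_right hu0
  have huu1 : u + u ≤ 1 := by
    rw [hu, ← add_smul]; simpa using smul_le_smul_right_of_nonneg ht1 (zero_le_one (α := F))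
  have h0I : (0 : F) ∈ Set.Icc 0 (u + u) := ⟨le_rfl, hu0.trans huu⟩
  have huI : u ∈ Set.Icc 0 (u + u) := ⟨hu0, huu⟩
  have h2I : u + u ∈ Set.Icc 0 (u + u) := ⟨hu0.trans huu, le_rfl⟩
  obtain ⟨κ, hκ, hκ1, -, hκm⟩ := exists_posComponent (k u)
  rw [posPart_of_nonneg hq] at hκ1
  obtain ⟨π, hπ, hπ1, hπ2, hπm⟩ := exists_posComponent (-k 0)
  have hπp : π * k 0 ≤ 0 := by
    rw [mul_neg] at hπ1
    exact neg_nonneg.mp (hπ1 ▸ posPart_nonneg _)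
  have hπp' : 0 ≤ (1 - π) * k 0 := by
    rw [mul_neg, neg_inj] at hπ2
    exact hπ2 ▸ negPart_nonneg _
  have hd : IsComponent (κ * (1 - π)) := hκ.mul hπ.compl
  set δ := κ * (1 - π) with hδ
  have hδp : 0 ≤ δ * k 0 := by rw [hδ, mul_assoc]; exact mul_nonneg hκ.nonneg hπp'
  -- `π` is where `k 0 < 0`, and `δ` is where `k 0 ≥ 0` and `k u > 0`. The search interval `[(1 - π)
  -- u, u + δ u]` is `[0, u]` on `π`, `[u, 2u]` on `δ` and the single point `u` on the rest.
  have hs : k (u + u) = -(k 0) - k u := by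
    rw [eq_neg_of_add_eq_zero_right hsum, neg_add']
  have hx : π * 0 + (1 - π) * u = (1 - π) * u := by rw [mul_zero, zero_add]
  have hy : δ * (u + u) + (1 - δ) * u = u + δ * u := by noncomm_ring
  have hxI := mem_Icc_of_component hπ h0I huI
  have hyI := mem_Icc_of_component hd h2I huI
  have hkx := hk.map_mix le_rfl huu1 hπ h0I huI
  have hky := hk.map_mix le_rfl huu1 hd h2I huI
  rw [hx] at hxI hkx
  rw [hy] at hyI hky
  have hle : (1 - π) * u ≤ u + δ * u := by
    have h1 : (1 - π) * u ≤ u := by simpa using mul_le_mul_of_nonneg_right hπ.compl.le_one hu0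
    exact h1.trans (le_add_of_nonneg_right (mul_nonneg hd.nonneg hu0))
  have hδq : (1 - π) * k u = δ * k u := by
    rw [hδ, hκ.commute, mul_assoc, hκ1]
  have hπδ : π * δ = 0 := by
    rw [hδ, ← mul_assoc, hπ.commute, mul_assoc, hπ.mul_compl_self, mul_zero]
  have hπδ' : (1 - π) * δ = δ := by rw [sub_mul, one_mul, hπδ, sub_zero]
  obtain ⟨z, hz, hkz⟩ := (hk.mono (Set.Icc_subset_Icc hxI.1 hyI.2)).exists_zero_of_sign hπ
    hxI.1 (hyI.2.trans huu1) hle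
    (by
      have h1 : (π - (1 - π)) * k ((1 - π) * u) = π * k 0 - (1 - π) * k u := by
        rw [hkx, sub_mul, hπ.mix_left, hπ.mix_right]
      rw [h1]
      exact sub_nonpos.mpr (hπp.trans (mul_nonneg hπ.compl_nonneg hq)))
    (by
      have h1 : (π - (1 - π)) * k (u + δ * u) = π * k u + δ * k 0 + δ * k u := by
        rw [hky, hs]
        have h2 : π * (δ * (-k 0 - k u) + (1 - δ) * k u) = π * k u := by
          have : π * (δ * (-k 0 - k u) + (1 - δ) * k u)
              = (π * δ) * (-k 0 - k u) + π * k u - (π * δ) * k u := by noncomm_ring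
          rw [this, hπδ]; simp
        have h3 : (1 - π) * (δ * (-k 0 - k u) + (1 - δ) * k u) = -(δ * k 0) - δ * k u := by
          have : (1 - π) * (δ * (-k 0 - k u) + (1 - δ) * k u)
              = ((1 - π) * δ) * (-k 0 - k u) + (1 - π) * k u - ((1 - π) * δ) * k u := by
            noncomm_ring
          rw [this, hπδ', hδq]; noncomm_ring
        rw [sub_mul, h2, h3]; abel
      rw [h1]
      exact add_nonneg (add_nonneg (mul_nonneg hπ.nonneg hq) hδp) (mul_nonneg hd.nonneg hq))
  have hzI : z ∈ Set.Icc 0 (u + u) := ⟨hxI.1.trans hz.1, hz.2.trans hyI.2⟩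
  refine ⟨z, hzI, hkz, ?_, ?_⟩
  -- If `z` vanishes on `d`, then `d` lies in `π`, while locality gives `d * k 0 = d * k z = 0`; but
  -- `k 0` is strictly negative on `π`.
  · refine isWeakOrderUnit_of_forall_component hzI.1 fun d hdc hdz => ?_
    have h1 : d * (1 - π) = 0 := by
      refine eq_zero_of_mul_smul_one_nonpos (mul_nonneg hdc.nonneg hπ.compl_nonneg) ht ?_
      rw [mul_assoc, ← hdz]
      exact mul_le_mul_of_nonneg_left hz.1 hdc.nonneg
    have h2 := hk.local le_rfl huu1 hdc h0I hzI (by rw [mul_zero, hdz])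
    rw [hkz, mul_zero] at h2
    have h3 := hπm d hdc (by rw [mul_neg, h2, neg_zero])
    rwa [mul_sub, mul_one, h3, sub_zero] at h1
  -- If `z = 2u` on `d`, then `d` lies in `δ` and `k (2u) = 0` there, so `k u = -k 0 ≤ 0` on `d`,
  -- against `k u > 0` on `δ`.
  · refine isWeakOrderUnit_of_forall_component (sub_nonneg.mpr hzI.2) fun d hdc hdz => ?_
    have h1 : d * (1 - δ) = 0 := by
      refine eq_zero_of_mul_smul_one_nonpos (mul_nonneg hdc.nonneg hd.compl_nonneg) ht ?_
      rw [← hdz, mul_assoc]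
      refine mul_le_mul_of_nonneg_left ?_ hdc.nonneg
      rw [le_sub_comm]
      refine hz.2.trans (le_of_eq ?_)
      rw [← hu]; noncomm_ring
    have hdδ : d * δ = d := by
      rw [mul_sub, mul_one, sub_eq_zero] at h1; exact h1.symm
    have h2 := hk.local le_rfl huu1 hdc h2I hzI
      (by rw [mul_sub, sub_eq_zero] at hdz; exact hdz)
    rw [hkz, mul_zero, hs, mul_sub, mul_neg, sub_eq_zero] at h2
    have h3 : d * k 0 = d * (δ * k 0) := by rw [← mul_assoc, hdδ]
    have h4 : d * k u ≤ 0 := by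
      rw [← h2, h3]
      exact neg_nonpos.mpr (mul_nonneg hdc.nonneg hδp)
    have h5 := hκm d hdc h4
    rw [← hdδ, hδ, ← mul_assoc, h5, zero_mul]

theorem exists_interior_zero {k : F → F} {t : ℝ} (ht : 0 < t) (ht1 : t + t ≤ 1)
    (hk : PointwiseLipOn k (Set.Icc 0 (t • (1 : F) + t • (1 : F))))
    (hsum : k 0 + k (t • 1) + k (t • 1 + t • 1) = 0) :
    ∃ z ∈ Set.Icc (0 : F) (t • 1 + t • 1), k z = 0 ∧ IsWeakOrderUnit z ∧
      IsWeakOrderUnit (t • (1 : F) + t • 1 - z) := by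
  obtain ⟨e, he, he1, he2, -⟩ := exists_posComponent (k (t • 1))
  obtain ⟨z, hz, hkz, h⟩ := exists_interior_zero_of_nonneg ht ht1 (hk.const_mul he.sign.1)
    (by rw [← mul_add, ← mul_add, hsum, mul_zero])
    (by
      rw [sub_mul, he1, he2, sub_neg_eq_add]
      exact add_nonneg (posPart_nonneg _) (negPart_nonneg _))
  exact ⟨z, hz, he.eq_zero_of_sign_mul hkz, h⟩

/-- Order differentiability on `[0, 1]`, tested on the sequence `2⁻ⁿ`. -/
def HasOrderDerivAt (h : F → F) (m x : F) : Prop :=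
  ∃ Eps : Set F, InfimumZero Eps ∧ ∀ ε ∈ Eps, ∃ n : ℕ, ∀ y ∈ Set.Icc (0 : F) 1,
    |y - x| ≤ (1 / 2 : ℝ) ^ n • (1 : F) → |h y - h x - (y - x) * m| ≤ |y - x| * ε

theorem pointwiseLipOn_of_hasOrderDerivAt {h h' : F → F}
    (hh : ∀ x ∈ Set.Icc (0 : F) 1, HasOrderDerivAt h (h' x) x) :
    PointwiseLipOn h (Set.Icc 0 1) := by
  intro x hx
  obtain ⟨Eps, hEps, hd⟩ := hh x hx
  by_cases hne : Eps.Nonempty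
  · obtain ⟨ε, hε⟩ := hne
    obtain ⟨n, hn⟩ := hd ε hε
    refine ⟨ε + |h' x|, add_nonneg (hEps.1 hε) (abs_nonneg _), n, fun y hy hyx => ?_⟩
    calc |h y - h x| = |(h y - h x - (y - x) * h' x) + (y - x) * h' x| := by rw [sub_add_cancel]
      _ ≤ |h y - h x - (y - x) * h' x| + |(y - x) * h' x| := abs_add_le _ _
      _ ≤ |y - x| * ε + |y - x| * |h' x| := add_le_add (hn y hy hyx) (abs_mul_le _ _)
      _ = |y - x| * (ε + |h' x|) := by rw [mul_add]
  · rw [Set.not_nonempty_iff_eq_empty] at hne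
    subst hne
    have hall : ∀ w : F, w ≤ 0 := fun w => hEps.2 (by simp [lowerBounds])
    exact ⟨0, le_rfl, 0, fun y _ _ => by simpa using hall _⟩

/-- The increments being real multiples of `1`, they can be cancelled; a general positive element of
`F` could not. -/
theorem eq_zero_of_forall_smul_abs_le {m : F} {Eps : Set F} (hEps : InfimumZero Eps)
    (h : ∀ ε ∈ Eps, ∃ t : ℝ, 0 < t ∧ |t • m| ≤ t • ε) : m = 0 := by
  have key : ∀ ε ∈ Eps, m ≤ ε ∧ -m ≤ ε := by
    intro ε hε
    obtain ⟨t, ht, h1⟩ := h ε hε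
    obtain ⟨h2, h3⟩ := abs_le'.mp h1
    constructor
    · rw [← sub_nonneg]
      refine nonneg_of_smul_nonneg ht ?_
      rw [smul_sub]; exact sub_nonneg.mpr h2
    · rw [← sub_nonneg]
      refine nonneg_of_smul_nonneg ht ?_
      rw [smul_sub, smul_neg]; exact sub_nonneg.mpr h3
  exact le_antisymm (hEps.2 fun ε hε => (key ε hε).1)
    (neg_nonpos.mp (hEps.2 fun ε hε => (key ε hε).2))

/-- Universal chord theorem for half of the length. -/
theorem PointwiseLipOn.exists_half_chord {h : F → F} (hh : PointwiseLipOn h (Set.Icc 0 1))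
    {x v : F} (hx : 0 ≤ x) (hv : 0 ≤ v) (h1 : x + v + v ≤ 1) (heq : h x = h (x + v + v)) :
    ∃ z ∈ Set.Icc x (x + v), h z = h (z + v) := by
  have hk : PointwiseLipOn (fun y => h (y + v) - h y) (Set.Icc x (x + v)) :=
    hh.shift_sub hx hv h1
  -- The two half-chord increments sum to zero, so `h (y + v) - h y` has opposite signs at `y = x`
  -- and `y = x + v` on each component.
  obtain ⟨e, he, he1, he2, -⟩ := exists_posComponent (h x - h (x + v))
  have hpos : 0 ≤ (e - (1 - e)) * (h x - h (x + v)) := by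
    rw [sub_mul, he1, he2, sub_neg_eq_add]
    exact add_nonneg (posPart_nonneg _) (negPart_nonneg _)
  obtain ⟨z, hz, hkz⟩ := hk.exists_zero_of_sign he hx ((le_add_of_nonneg_right hv).trans h1)
    (le_add_of_nonneg_right hv)
    (by rw [← neg_sub (h x), mul_neg]; exact neg_nonpos.mpr hpos)
    (by rw [← heq]; exact hpos)
  exact ⟨z, hz, (sub_eq_zero.mp hkz).symm⟩

/-- Rolle's theorem. -/
theorem exists_hasOrderDerivAt_eq_zero {h h' : F → F}
    (hh : ∀ x ∈ Set.Icc (0 : F) 1, HasOrderDerivAt h (h' x) x) (heq : h 0 = h 1) :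
    ∃ x ∈ orderOpenInterval (0 : F) 1, h' x = 0 := by
  have hlip := pointwiseLipOn_of_hasOrderDerivAt hh
  set u : F := (1 / 3 : ℝ) • (1 : F) with hu
  have hu0 : 0 ≤ u := smul_nonneg (by norm_num) zero_le_one
  have hu3 : u + u + u = 1 := by
    rw [hu, ← add_smul, ← add_smul]; norm_num
  have hk : PointwiseLipOn (fun y => h (y + u) - h y) (Set.Icc 0 (u + u)) :=
    hlip.shift_sub le_rfl hu0 hu3.le
  -- The three increments of `h` over thirds telescope to `h 1 - h 0 = 0`. Starting from thirds
  -- keeps the chord off both ends; a chord of length `1/2` might be forced to start at `0` or at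
  -- `1/2`.
  obtain ⟨a, ha, hka, ha0, ha1⟩ := exists_interior_zero (t := 1 / 3) (by norm_num) (by norm_num)
    hk (by
      simp only [← hu, zero_add, hu3, ← heq]
      abel)
  rw [← hu] at ha ha1
  have hau : a + u ≤ 1 := by rw [← hu3]; exact add_le_add_left ha.2 u
  let R : F → F → Prop := fun x y => 0 ≤ x ∧ y ≤ 1 ∧ h x = h y ∧
    ∃ t : ℝ, 0 < t ∧ y - x = t • (1 : F)
  have hstep : ∀ x y, x ≤ y → R x y → ∃ x' y', x ≤ x' ∧ x' ≤ y' ∧ y' ≤ y ∧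
      y' - x' = (1 / 2 : ℝ) • (y - x) ∧ R x' y' := by
    rintro x y hxy ⟨hx, hy, hR, t, ht, hlen⟩
    set v := (1 / 2 : ℝ) • (y - x) with hv
    have hv0 : 0 ≤ v := half_smul_sub_nonneg hxy
    have hvv : x + v + v = y := by
      have : v + v = y - x := by rw [hv, ← add_smul]; norm_num
      rw [add_assoc, this]; abel
    obtain ⟨z, hz, hzv⟩ := hlip.exists_half_chord hx hv0 (hvv.trans_le hy) (by rw [hvv]; exact hR)
    have hzy : z + v ≤ y := by rw [← hvv]; exact add_le_add_left hz.2 v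
    refine ⟨z, z + v, hz.1, le_add_of_nonneg_right hv0, hzy, by abel, hx.trans hz.1,
      hzy.trans hy, hzv, 1 / 2 * t, by positivity, ?_⟩
    rw [add_sub_cancel_left, hv, hlen, smul_smul]
  obtain ⟨z, hz, hzn⟩ := exists_mem_nested hstep (a := a) (b := a + u) (le_add_of_nonneg_right hu0)
    ⟨ha.1, hau, (sub_eq_zero.mp hka).symm, 1 / 3, by norm_num, by abel⟩
  have hzI : z ∈ Set.Icc (0 : F) 1 := ⟨ha.1.trans hz.1, hz.2.trans hau⟩
  refine ⟨z, ⟨?_, ?_⟩, ?_⟩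
  · change IsWeakOrderUnit (z - 0)
    rw [sub_zero]
    exact isWeakOrderUnit_mono ha0 hz.1
  · refine isWeakOrderUnit_mono ha1 ?_
    rw [← hu3]
    calc u + u - a = u + u + u - (a + u) := by abel
      _ ≤ u + u + u - z := sub_le_sub_left hz.2 _
  · obtain ⟨Eps, hEps, hd⟩ := hh z hzI
    refine eq_zero_of_forall_smul_abs_le hEps fun ε hε => ?_
    obtain ⟨n, hn⟩ := hd ε hε
    obtain ⟨x, y, hax, hxz, hzy, hyb, hlen, hx0, hy1, hxy, t, ht, hlen'⟩ := hzn n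
    have hxy' : x ≤ y := hxz.trans hzy
    have hsmall : y - x ≤ (1 / 2 : ℝ) ^ n • (1 : F) := by
      rw [hlen, add_sub_cancel_left]
      exact smul_le_smul_of_nonneg_left (hu3 ▸ le_add_of_nonneg_left (add_nonneg hu0 hu0))
        (by positivity)
    have hx := hn x ⟨hx0, hxy'.trans hy1⟩ ((abs_sub_le_sub_of_mem_Icc (a := x) (b := y)
      ⟨hxz, hzy⟩ ⟨le_rfl, hxy'⟩).trans hsmall)
    have hy := hn y ⟨hx0.trans hxy', hy1⟩ ((abs_sub_le_sub_of_mem_Icc (a := x) (b := y)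
      ⟨hxz, hzy⟩ ⟨hxy', le_rfl⟩).trans hsmall)
    rw [abs_sub_comm x z, abs_of_nonneg (sub_nonneg.mpr hxz)] at hx
    rw [abs_of_nonneg (sub_nonneg.mpr hzy)] at hy
    refine ⟨t, ht, ?_⟩
    -- Since `h x = h y`, the term `(y - x) h' z` is the difference of the two linearization errors
    -- at `x ≤ z ≤ y`, whose bounds add up to `(y - x) ε`.
    calc |t • h' z| = |(y - x) * h' z| := by rw [hlen', smul_mul_assoc, one_mul]
      _ = |(h x - h z - (x - z) * h' z) + -(h y - h z - (y - z) * h' z)| := by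
          rw [hxy]; congr 1; noncomm_ring
      _ ≤ |h x - h z - (x - z) * h' z| + |-(h y - h z - (y - z) * h' z)| := abs_add_le _ _
      _ ≤ (z - x) * ε + (y - z) * ε := by rw [abs_neg]; exact add_le_add hx hy
      _ = t • ε := by rw [← add_mul, add_comm, sub_add_sub_cancel, hlen', smul_mul_assoc, one_mul]

end Rolle

end PhiAlgebra

namespace Complexification

open PhiAlgebra

/-! ### Reduction of the complex theorem to Rolle's theorem -/

section MeanValue

variable {F : Type*} [Ring F] [ConditionallyCompleteLattice F] [Algebra ℝ F] [IsPhiAlgebra F]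

theorem cos_smul_add_sin_smul_le_modulus (z : Complexification F) {θ : ℝ}
    (hθ : θ ∈ Set.Icc 0 (2 * Real.pi)) :
    Real.cos θ • z.re + Real.sin θ • z.im ≤ modulus z :=
  (isLUB_modulus z).1 ⟨θ, hθ, rfl⟩

theorem abs_re_le_modulus (z : Complexification F) : |z.re| ≤ modulus z := by
  have h0 := cos_smul_add_sin_smul_le_modulus z (θ := 0) ⟨le_rfl, by positivity⟩
  have h1 := cos_smul_add_sin_smul_le_modulus z (θ := Real.pi)
    ⟨Real.pi_pos.le, by linarith [Real.pi_pos]⟩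
  simp only [Real.cos_zero, Real.sin_zero, Real.cos_pi, Real.sin_pi, one_smul, neg_smul, zero_smul,
    add_zero] at h0 h1
  exact abs_le'.mpr ⟨h0, h1⟩

theorem abs_im_le_modulus (z : Complexification F) : |z.im| ≤ modulus z := by
  have h0 := cos_smul_add_sin_smul_le_modulus z (θ := Real.pi / 2)
    ⟨by positivity, by linarith [Real.pi_pos]⟩
  have h1 := cos_smul_add_sin_smul_le_modulus z (θ := Real.pi / 2 + Real.pi)
    ⟨by positivity, by linarith [Real.pi_pos]⟩
  simp only [Real.cos_pi_div_two, Real.sin_pi_div_two, Real.cos_add_pi, Real.sin_add_pi, one_smul,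
    neg_smul, zero_smul, neg_zero, zero_add] at h0 h1
  exact abs_le'.mpr ⟨h0, h1⟩

theorem modulus_le {z : Complexification F} {y : F}
    (h : ∀ θ : ℝ, θ ∈ Set.Icc 0 (2 * Real.pi) → Real.cos θ • z.re + Real.sin θ • z.im ≤ y) :
    modulus z ≤ y :=
  (isLUB_modulus z).2 (by rintro _ ⟨θ, hθ, rfl⟩; exact h θ hθ)

theorem modulus_le_abs_add_abs (z : Complexification F) : modulus z ≤ |z.re| + |z.im| :=
  modulus_le fun θ _ => add_le_add (smul_le_abs_of_abs_le_one _ (Real.abs_cos_le_one θ) _)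
    (smul_le_abs_of_abs_le_one _ (Real.abs_sin_le_one θ) _)

theorem modulus_segment_le (a b c : Complexification F) {x : F} (hx : x ∈ Set.Icc (0 : F) 1) :
    modulus (a + ofReal x * (b - a) - c) ≤ (1 - x) * modulus (a - c) + x * modulus (b - c) := by
  refine modulus_le fun θ hθ => ?_
  have h1 := mul_le_mul_of_nonneg_left (cos_smul_add_sin_smul_le_modulus (a - c) hθ)
    (sub_nonneg.mpr hx.2)
  have h2 := mul_le_mul_of_nonneg_left (cos_smul_add_sin_smul_le_modulus (b - c) hθ) hx.1
  refine le_trans (le_of_eq ?_) (add_le_add h1 h2)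
  have hre : (a + ofReal x * (b - a) - c).re = (1 - x) * (a - c).re + x * (b - c).re := by
    simp only [sub_re, add_re, mul_re, ofReal_re, ofReal_im, zero_mul, sub_zero]
    noncomm_ring
  have him : (a + ofReal x * (b - a) - c).im = (1 - x) * (a - c).im + x * (b - c).im := by
    simp only [sub_im, add_im, mul_im, ofReal_re, ofReal_im, zero_mul, add_zero]
    noncomm_ring
  rw [hre, him]
  simp only [smul_add, mul_add, mul_smul_comm]
  abel

/-- Order neighbourhoods are order convex. -/
theorem segment_mem_orderNhd {a b c : Complexification F} {r x : F} (ha : a ∈ orderNhd c r)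
    (hb : b ∈ orderNhd c r) (hx : x ∈ Set.Icc (0 : F) 1) :
    a + ofReal x * (b - a) ∈ orderNhd c r := by
  refine isWeakOrderUnit_mono (isWeakOrderUnit_convexComb ha hb hx.1 hx.2) ?_
  calc (1 - x) * (r - modulus (a - c)) + x * (r - modulus (b - c))
      = r - ((1 - x) * modulus (a - c) + x * modulus (b - c)) := by noncomm_ring
    _ ≤ _ := sub_le_sub_left (modulus_segment_le a b c hx) r

/-- A real linear coordinate of the complexification. -/
structure IsCoordinate (P : Complexification F → F) : Prop where
  map_sub : ∀ z w, P (z - w) = P z - P w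
  map_ofReal_mul : ∀ x z, P (ofReal x * z) = x * P z
  abs_le : ∀ z, |P z| ≤ modulus z

theorem isCoordinate_re : IsCoordinate (re : Complexification F → F) :=
  ⟨fun _ _ => rfl, fun x z => by simp, abs_re_le_modulus⟩

theorem isCoordinate_im : IsCoordinate (im : Complexification F → F) :=
  ⟨fun _ _ => rfl, fun x z => by simp, abs_im_le_modulus⟩

theorem IsCoordinate.hasOrderDerivAt {P : Complexification F → F} (hP : IsCoordinate P)
    {f : Complexification F → Complexification F} {D : Set (Complexification F)}
    {a b m : Complexification F} {x : F}
    (hD : ∀ y ∈ Set.Icc (0 : F) 1, a + ofReal y * (b - a) ∈ D)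
    (hf : HasSuperOrderDerivAt f D m (a + ofReal x * (b - a))) (K : F) :
    HasOrderDerivAt (fun y => P (f (a + ofReal y * (b - a))) - y * K) (P ((b - a) * m) - K) x := by
  obtain ⟨-, r, -, -, hΔ⟩ := hf
  set w := b - a
  set N : F := |w.re| + |w.im| with hN
  have hN0 : 0 ≤ N := add_nonneg (abs_nonneg _) (abs_nonneg _)
  -- `N` dominates the modulus of `b - a`, so `|y - x| ≤ 2⁻ⁿ` puts the displacement below `2⁻ⁿ N`.
  -- The error bound becomes `|y - x| N ε`, and the elements `N ε` still have infimum `0`.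
  obtain ⟨Eps, hEps, h⟩ := hΔ _ (infimumZero_smul_half_pow hN0)
  refine ⟨_, infimumZero_mul_left hN0 hEps, ?_⟩
  rintro _ ⟨ε, hε, rfl⟩
  obtain ⟨_, ⟨n, rfl⟩, hn⟩ := h ε hε
  refine ⟨n, fun y hy hyx => ?_⟩
  have hdiff : a + ofReal y * w - (a + ofReal x * w) = ofReal (y - x) * w := by
    ext <;> simp <;> noncomm_ring
  have hmod : modulus (ofReal (y - x) * w) ≤ |y - x| * N := by
    refine (modulus_le_abs_add_abs _).trans ?_
    simp only [mul_re, mul_im, ofReal_re, ofReal_im, zero_mul, sub_zero, add_zero]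
    rw [hN, mul_add]
    exact add_le_add (abs_mul_le _ _) (abs_mul_le _ _)
  have hsmall : |y - x| * N ≤ (1 / 2 : ℝ) ^ n • N := by
    simpa using mul_le_mul_of_nonneg_right hyx hN0
  have h1 := hn _ (hD y hy) (by rw [hdiff]; exact hmod.trans hsmall)
  rw [hdiff] at h1
  have h2 := (hP.abs_le _).trans (h1.trans (mul_le_mul_of_nonneg_right hmod (hEps.1 hε)))
  rw [hP.map_sub, hP.map_sub, mul_assoc, hP.map_ofReal_mul, mul_assoc] at h2
  refine le_trans (le_of_eq ?_) h2
  congr 1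
  noncomm_ring

/-- The mean value theorem for one coordinate. -/
theorem IsCoordinate.exists_mean_value {P : Complexification F → F} (hP : IsCoordinate P)
    {f f' : Complexification F → Complexification F} {D : Set (Complexification F)}
    {a b : Complexification F} (hD : ∀ y ∈ Set.Icc (0 : F) 1, a + ofReal y * (b - a) ∈ D)
    (hf : ∀ z ∈ D, HasSuperOrderDerivAt f D (f' z) z) :
    ∃ u ∈ orderOpenSegment a b, P ((b - a) * f' u) = P (f b - f a) := by
  have h0 : a + ofReal 0 * (b - a) = a := by ext <;> simp
  have h1 : a + ofReal 1 * (b - a) = b := by ext <;> simp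
  obtain ⟨x, hx, hx0⟩ := exists_hasOrderDerivAt_eq_zero
    (fun x hx => hP.hasOrderDerivAt hD (hf _ (hD x hx)) (P (f b - f a)))
    (by simp only [h0, h1, hP.map_sub, zero_mul, one_mul]; abel)
  exact ⟨_, ⟨x, hx, rfl⟩, sub_eq_zero.mp hx0⟩

end MeanValue

end Complexification

theorem mainTheorem10 {F : Type*} [Ring F] [ConditionallyCompleteLattice F] [Algebra ℝ F]
    [IsPhiAlgebra F] (c : Complexification F) (r : F) (hr : IsWeakOrderUnit r)
    (f f' : Complexification F → Complexification F)
    (hf : ∀ z ∈ Complexification.orderNhd c r,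
      Complexification.HasSuperOrderDerivAt f (Complexification.orderNhd c r) (f' z) z)
    (a b : Complexification F) (ha : a ∈ Complexification.orderNhd c r)
    (hb : b ∈ Complexification.orderNhd c r) :
    ∃ u ∈ Complexification.orderOpenSegment a b, ∃ v ∈ Complexification.orderOpenSegment a b,
      ((b - a) * f' u).re = (f b - f a).re ∧ ((b - a) * f' v).im = (f b - f a).im := by
  have hD : ∀ y ∈ Set.Icc (0 : F) 1,
      a + Complexification.ofReal y * (b - a) ∈ Complexification.orderNhd c r :=
    fun y hy => Complexification.segment_mem_orderNhd ha hb hy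
  obtain ⟨u, hu, h1⟩ := Complexification.isCoordinate_re.exists_mean_value hD hf
  obtain ⟨v, hv, h2⟩ := Complexification.isCoordinate_im.exists_mean_value hD hf
  exact ⟨u, hu, v, hv, h1, h2⟩
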